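/- **Setting.** Let $X=(X_i)_{i\in I}$ be finitely many variables with values in arbitrary measurable spaces, and for $s\subseteq I$ write $x_s$ and $x_{-s}$ for the restrictions of $x$ to $s$ and to its complement. A *dependency network* $N$ is a family of conditional distributions (Markov kernels) $P_s(x_s\mid x_{-s})$, $s\subseteq I$; they are not required to be the conditionals of any joint distribution. Let $p$ be a probability distribution on the subsets of $I$ (for instance supported on the singletons). The *GSN chain* of $N$ has state $(X_t,H_t)$: draw $s\sim p$ independently of the past, put $H_{t+1}=(s,(X_t)_{-s})$, and let $X_{t+1}$ agree with $X_t$ outside $s$ while $(X_{t+1})_s\sim P_s(\cdot\mid (X_t)_{-s})$. The component $X_t$ is itself a Markov chain, the *visible chain*. For a probability distribution $\pi$ of $X$ let $R_s\pi$ be the law obtained from $X\sim\pi$ by redrawing $X_s$ from $P_s(\cdot\mid X_{-s})$. We say that $N$ *defines the joint distribution* $\pi$ if $\pi$ is a probability distribution and $\pi=\sum_s p(s)\,R_s\pi$. Let $\|\cdot\|$ be the total variation distance, $\|\mu-\nu\|=\sup_A|\mu(A)-\nu(A)|$. **Proposition.** 1. $N$ defines the joint distribution $\pi$ if and only if $\pi$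 is the $X$-marginal of a stationary distribution of the GSN chain. In particular, if the chain has a stationary distribution, its $X$-marginal is a joint distribution defined by $N$. If $N$ defines $\pi$ and $X_0\sim\pi$, then $X_t\sim\pi$ for all $t$. 2. If a probability distribution $\mu$ is the asymptotic distribution of the GSN chain (from every initial state the law at time $t$ converges to $\mu$ in total variation), then $\mu$ is the unique stationary distribution of the chain, its $X$-marginal is the unique joint distribution defined by $N$, and from every initial state the law of $X_t$ converges to it in total variation. 3. Let $P$ be a (ground truth) joint distribution of $X$ and $N^0$ a dependency network such that, for every $s$ with $p(s)>0$, its kernel $P^0_s(x_s\mid x_{-s})$ is a version of the conditional distribution of $X_s$ given $X_{-s}$ under $P$. Let $N^{(n)}$, $n\in\mathbb N$, be random dependency networks (estimates, functions of random data) with conditionals $P^{(n)}_s$, and suppose that for each $n$, almost surely, $\mu_n$ is a stationary distribution of the GSN chain of $N^{(n)}$; let $\pi_n$ be its $X$-marginal. Then $\|\pi_n-P\|\to0$ in each of the following cases. (a) The visible chain of $N^0$ is uniformly ergodic (for some probability distribution, the law at time $t$ converges to it in total variation uniformly in the initial state) and, for every $s$ with $p(s)>0$, $\sup_{y}\|P^{(n)}_s(\cdot\mid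 y)-P^0_s(\cdot\mid y)\|\to0$. (b) Each variable takes finitely many values (all singletons being measurable), the visible chain of $N^0$ is $P$-irreducible (every $x$ with $P(x)>0$ is reached with positive probability from every initial state), and $P^{(n)}_s(z\mid y)\to P^0_s(z\mid y)$ for all $s$ with $p(s)>0$ and all values $y$ of $x_{-s}$ and $z$ of $x_s$. In both cases the statement holds with convergence in probability in hypothesis and conclusion (consistency), and also with almost sure convergence in both (strong consistency). -/

import Mathlib

open MeasureTheory ProbabilityTheory Filter Topology
open scoped ENNReal

noncomputable section

namespace DepNet

variable {ι : Type*} {X : ι → Type*}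

/-- Values `x_s` of the variables whose index lies in `s`. -/
abbrev Part (X : ι → Type*) (s : Finset ι) : Type _ := ∀ i : {i // i ∈ s}, X i

/-- Values `x_{-s}` of the variables whose index does not lie in `s`. -/
abbrev Rest (X : ι → Type*) (s : Finset ι) : Type _ := ∀ i : {i // i ∉ s}, X i

/-- The restriction `x ↦ x_s`. -/
def part (s : Finset ι) (x : ∀ i, X i) : Part X s := fun i => x i

/-- The restriction `x ↦ x_{-s}`. -/
def rest (s : Finset ι) (x : ∀ i, X i) : Rest X s := fun i => x i

/-- The configuration whose restriction to the complement of `s` is `y`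
and whose restriction to `s` is `z`. -/
def glue [DecidableEq ι] (s : Finset ι) (y : Rest X s) (z : Part X s) : ∀ i, X i :=
  fun i => if h : i ∈ s then z ⟨i, h⟩ else y ⟨i, h⟩

variable [∀ i, MeasurableSpace (X i)]

/-- A (generalized) dependency network: for every set `s` of variables a conditional distribution
`P_s(x_s | x_{-s})`. The conditionals for different `s` are unrelated: no joint distribution
having them as conditionals is required to exist. -/
structure DependencyNetwork (X : ι → Type*) [∀ i, MeasurableSpace (X i)] where
  /-- the conditional distribution of `x_s` given `x_{-s}` -/
  cond : ∀ s : Finset ι, Kernel (Rest X s) (Part X s)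
  /-- each conditional is a probability distribution -/
  markov : ∀ s, IsMarkovKernel (cond s)

instance (N : DependencyNetwork X) (s : Finset ι) : IsMarkovKernel (N.cond s) := N.markov s

/-- The values of the latent variable `H`: a set `s` of variables to be resampled,
together with the values `x_{-s}` of the other variables. -/
abbrev Latent (X : ι → Type*) : Type _ := Σ s : Finset ι, Rest X s

theorem measurable_part (s : Finset ι) : Measurable (part (X := X) s) :=
  measurable_pi_lambda _ fun _ => measurable_pi_apply _

theorem measurable_rest (s : Finset ι) : Measurable (rest (X := X) s) :=
  measurable_pi_lambda _ fun _ => measurable_pi_apply _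

theorem measurable_mk (s : Finset ι) : Measurable (fun y : Rest X s => (⟨s, y⟩ : Latent X)) := by
  intro A hA
  exact (MeasurableSpace.measurableSet_iInf.1 hA s : _)

theorem measurable_latent {β : Type*} [MeasurableSpace β] {f : Latent X → β}
    (hf : ∀ s, Measurable fun y : Rest X s => f ⟨s, y⟩) : Measurable f := by
  intro A hA
  exact MeasurableSpace.measurableSet_iInf.2 fun s => hf s hA

variable [DecidableEq ι]

theorem measurable_glue (s : Finset ι) :
    Measurable (fun q : Rest X s × Part X s => glue s q.1 q.2) := by
  refine measurable_pi_lambda _ fun i => ?_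
  by_cases h : i ∈ s
  · simp only [glue, h, dite_true]
    exact (measurable_pi_apply _).comp measurable_snd
  · simp only [glue, h, dite_false]
    exact (measurable_pi_apply _).comp measurable_fst

/-- The reconstruction `P(X | H)`: given `H = (s, x_{-s})` keep `x_{-s}` and draw `x_s` from the
conditional distribution of the network. -/
def reconstruction (N : DependencyNetwork X) : Kernel (Latent X) (∀ i, X i) where
  toFun h := (N.cond h.1 h.2).map (glue h.1 h.2)
  measurable' := by
    refine measurable_latent fun s => ?_
    refine Measure.measurable_of_measurable_coe _ fun A hA => ?_
    have h1 : ∀ y : Rest X s, Measurable (glue (X := X) s y) := fun y =>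
      (measurable_glue s).comp measurable_prodMk_left
    simp only [Measure.map_apply (h1 _) hA]
    exact Kernel.measurable_kernel_prodMk_left (κ := N.cond s) ((measurable_glue s) hA)

instance (N : DependencyNetwork X) : IsMarkovKernel (reconstruction N) :=
  ⟨fun h => Measure.isProbabilityMeasure_map
    ((measurable_glue h.1).comp measurable_prodMk_left).aemeasurable⟩

variable [Fintype ι]

/-- The corruption `C(H | X)`: draw `s` with law `p`, independently of `X`,
and let `H = (s, X_{-s})`. -/
def corruption (p : PMF (Finset ι)) : Kernel (∀ i, X i) (Latent X) where
  toFun x := ∑ s, p s • Measure.dirac (⟨s, rest s x⟩ : Latent X)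
  measurable' := by
    refine Measure.measurable_of_measurable_coe _ fun A hA => ?_
    simp only [Measure.coe_finsetSum, Finset.sum_apply, Measure.smul_apply, smul_eq_mul]
    refine Finset.measurable_sum _ fun s _ => Measurable.const_mul ?_ _
    exact (Measure.measurable_coe hA).comp
      (Measure.measurable_dirac.comp ((measurable_mk s).comp (measurable_rest s)))

instance (p : PMF (Finset ι)) : IsMarkovKernel (corruption (X := X) p) := by
  refine ⟨fun x => ⟨?_⟩⟩
  change (∑ s, p s • Measure.dirac (⟨s, rest s x⟩ : Latent X)) Set.univ = 1
  simp only [Measure.coe_finsetSum, Finset.sum_apply, Measure.smul_apply, smul_eq_mul,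
    measure_univ, mul_one]
  rw [← tsum_fintype (L := .unconditional _)]
  exact p.tsum_coe

/-- The GSN Markov chain with state `(X_t, H_t)`:
`H_{t+1} ∼ C(H | X_t)` and then `X_{t+1} ∼ P(X | H_{t+1})`. -/
def gsn (N : DependencyNetwork X) (p : PMF (Finset ι)) :
    Kernel ((∀ i, X i) × Latent X) ((∀ i, X i) × Latent X) :=
  (((corruption p) ⊗ₖ (Kernel.prodMkLeft (∀ i, X i) (reconstruction N))).map Prod.swap).comap
    Prod.fst measurable_fst

/-- The transition `X_t ↦ X_{t+1}` of the visible component of the GSN chain. -/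
def visible (N : DependencyNetwork X) (p : PMF (Finset ι)) : Kernel (∀ i, X i) (∀ i, X i) :=
  reconstruction N ∘ₖ corruption p

/-- `μ` is a stationary distribution of the GSN chain of the network `N`. -/
def IsStationary (N : DependencyNetwork X) (p : PMF (Finset ι))
    (μ : Measure ((∀ i, X i) × Latent X)) : Prop :=
  IsProbabilityMeasure μ ∧ (gsn N p).Invariant μ

/-- The law of `x` after `x_s` is redrawn from the conditional of the network, when `x ∼ π`. -/
def resample (N : DependencyNetwork X) (s : Finset ι) (π : Measure (∀ i, X i)) :
    Measure (∀ i, X i) :=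
  ((π.map (rest s)) ⊗ₘ (N.cond s)).map (fun q => glue s q.1 q.2)

/-- `π` is a joint distribution of all the variables defined by the dependency network under
random-scan resampling: a probability distribution which is the mixture, over the random subset
`s`, of the distributions obtained by extending its own marginal on `x_{-s}` by the conditional
`P_s` of the network. -/
def DefinesJoint (N : DependencyNetwork X) (p : PMF (Finset ι)) (π : Measure (∀ i, X i)) : Prop :=
  IsProbabilityMeasure π ∧ π = ∑ s, p s • resample N s π

/-- `N` consists, for each `s` that can be selected, of (a version of) the conditional distribution
of `x_s` given `x_{-s}` under the joint distribution `P`. -/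
def IsTrueConditionals (P : Measure (∀ i, X i)) (p : PMF (Finset ι))
    (N : DependencyNetwork X) : Prop :=
  ∀ s ∈ p.support, (P.map (fun x => (rest s x, part s x))).IsCondKernel (N.cond s)

/-- Total variation distance of two probability measures. -/
def tv {α : Type*} [MeasurableSpace α] (μ ν : Measure α) : ℝ≥0∞ :=
  ⨆ (A : Set α) (_ : MeasurableSet A), ENNReal.ofReal |μ.real A - ν.real A|

/-- `μ` is the asymptotic distribution of the Markov chain `κ` from every initial state. -/
def IsAsymptotic {α : Type*} [MeasurableSpace α] (κ : Kernel α α) (μ : Measure α) : Prop :=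
  IsProbabilityMeasure μ ∧ ∀ z, Tendsto (fun t : ℕ => tv ((κ ^ t) z) μ) atTop (𝓝 0)

/-- Uniform ergodicity: the chain converges to some probability distribution in total variation,
uniformly in the initial state. -/
def UniformlyErgodic {α : Type*} [MeasurableSpace α] (κ : Kernel α α) : Prop :=
  ∃ μ : Measure α, IsProbabilityMeasure μ ∧
    Tendsto (fun t : ℕ => ⨆ z, tv ((κ ^ t) z) μ) atTop (𝓝 0)

/-- The error of the conditional `P_s` of `N` as an approximation to that of `N₀`, uniformly over
the values of the conditioning variables. -/
def condError (N N₀ : DependencyNetwork X) (s : Finset ι) : ℝ≥0∞ :=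
  ⨆ y : Rest X s, tv (N.cond s y) (N₀.cond s y)

end DepNet

end

/-! The GSN transition depends on `(X_t, H_t)` only through `X_t`. A law `π` that is invariant for
`visible` therefore lifts to a stationary law by one GSN step, and the visible marginal of any
stationary law is invariant for `visible`. Since `π.bind (visible N p)` is the mixture of the
resampled laws (`bind_visible`), invariance is exactly `DefinesJoint`. The asymptotic claims use
that Markov kernels contract total variation, together with dominated convergence for uniqueness.

Consistency is a perturbation statement (`StablyStationary`): `P` is invariant for the true visible
chain `κ`, and a law `π` invariant for a kernel within `d` of `κ` is moved by at most `k * d` under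
`κ ^ k` (`tv_bind_pow_le`). Under uniform ergodicity a single large `k` brings `π.bind (κ ^ k)`
close to `P`. In the finite irreducible case the chain may be periodic, so powers need not converge;
sums of the first `M` powers replace them, and their uniform mass at one atom gives a contraction
(`stablyStationary_of_isIrreducible`). The resulting deterministic ε-δ bound then carries either
mode of convergence from the conditionals to the joint law. -/

namespace DepNet

/-! ### Total variation: integrals and contraction under kernels -/

section TotalVariation

variable {α β : Type*} [MeasurableSpace α] [MeasurableSpace β]

theorem tv_le_iff {μ ν : Measure α} {r : ℝ≥0∞} :
    tv μ ν ≤ r ↔ ∀ A, MeasurableSet A → ENNReal.ofReal |μ.real A - ν.real A| ≤ r := by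
  simp [tv, iSup_le_iff]

theorem ofReal_abs_le_tv (μ ν : Measure α) {A : Set α} (hA : MeasurableSet A) :
    ENNReal.ofReal |μ.real A - ν.real A| ≤ tv μ ν :=
  tv_le_iff.1 le_rfl A hA

theorem tv_comm (μ ν : Measure α) : tv μ ν = tv ν μ := by
  simp only [tv, abs_sub_comm]

theorem tv_triangle (μ ν ρ : Measure α) : tv μ ρ ≤ tv μ ν + tv ν ρ := by
  refine tv_le_iff.2 fun A hA => ?_
  calc ENNReal.ofReal |μ.real A - ρ.real A|
      ≤ ENNReal.ofReal (|μ.real A - ν.real A| + |ν.real A - ρ.real A|) :=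
        ENNReal.ofReal_le_ofReal (abs_sub_le _ _ _)
    _ ≤ _ := ENNReal.ofReal_add_le
    _ ≤ _ := add_le_add (ofReal_abs_le_tv _ _ hA) (ofReal_abs_le_tv _ _ hA)

theorem tv_map_le (μ ν : Measure α) {f : α → β} (hf : Measurable f) :
    tv (μ.map f) (ν.map f) ≤ tv μ ν := by
  refine tv_le_iff.2 fun A hA => ?_
  rw [map_measureReal_apply hf hA, map_measureReal_apply hf hA]
  exact ofReal_abs_le_tv μ ν (hf hA)

theorem measurable_kernel_real (κ : Kernel α β) {A : Set β} (hA : MeasurableSet A) :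
    Measurable fun x => (κ x).real A :=
  (κ.measurable_coe hA).ennreal_toReal

theorem bind_real_apply (μ : Measure α) (κ : Kernel α β) [IsMarkovKernel κ] {A : Set β}
    (hA : MeasurableSet A) : (μ.bind κ).real A = ∫ x, (κ x).real A ∂μ := by
  rw [Measure.real, Measure.bind_apply hA κ.aemeasurable]
  exact (integral_toReal (κ.measurable_coe hA).aemeasurable
    (ae_of_all _ fun x => measure_lt_top _ _)).symm

variable (μ ν : Measure α) [IsProbabilityMeasure μ] [IsProbabilityMeasure ν]

theorem tv_le_one : tv μ ν ≤ 1 := by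
  refine tv_le_iff.2 fun A _ => ?_
  rw [← ENNReal.ofReal_one]
  refine ENNReal.ofReal_le_ofReal (abs_le.2 ⟨?_, ?_⟩) <;>
  linarith [measureReal_nonneg (μ := μ) (s := A), measureReal_nonneg (μ := ν) (s := A),
    measureReal_le_one (μ := μ) (s := A), measureReal_le_one (μ := ν) (s := A)]

theorem tv_ne_top : tv μ ν ≠ ∞ := ((tv_le_one μ ν).trans_lt ENNReal.one_lt_top).ne

theorem abs_real_sub_le_toReal_tv {A : Set α} (hA : MeasurableSet A) :
    |μ.real A - ν.real A| ≤ (tv μ ν).toReal :=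
  (ENNReal.ofReal_le_iff_le_toReal (tv_ne_top μ ν)).1 (ofReal_abs_le_tv μ ν hA)

theorem eq_of_tv_eq_zero {μ ν : Measure α} [IsProbabilityMeasure μ] [IsProbabilityMeasure ν]
    (h : tv μ ν = 0) : μ = ν := by
  ext A hA
  have h1 := abs_real_sub_le_toReal_tv μ ν hA
  rw [h, ENNReal.toReal_zero] at h1
  have h2 : μ.real A = ν.real A := sub_eq_zero.1 (abs_nonpos_iff.1 h1)
  exact (ENNReal.toReal_eq_toReal_iff' (measure_ne_top _ _) (measure_ne_top _ _)).1 h2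

/-- Layer cake: each integral is the integral over `t` in `(0, M]` of the mass of `{t ≤ f}`, and
these masses differ by at most the total variation distance. -/
theorem abs_integral_sub_le_of_nonneg {f : α → ℝ} (hf : Measurable f) {M : ℝ}
    (h0 : ∀ x, 0 ≤ f x) (hM : ∀ x, f x ≤ M) :
    |∫ x, f x ∂μ - ∫ x, f x ∂ν| ≤ M * (tv μ ν).toReal := by
  have hM0 : 0 ≤ M := by
    obtain ⟨x⟩ : Nonempty α := μ.nonempty_of_neZero
    exact (h0 x).trans (hM x)
  have hint : ∀ (ρ : Measure α) [IsProbabilityMeasure ρ], Integrable f ρ := fun ρ _ =>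
    Integrable.of_bound hf.aestronglyMeasurable M
      (ae_of_all _ fun x => by rw [Real.norm_eq_abs, abs_of_nonneg (h0 x)]; exact hM x)
  have hlc : ∀ (ρ : Measure α) [IsProbabilityMeasure ρ],
      ∫ x, f x ∂ρ = ∫ t in Set.Ioc 0 M, ρ.real {a : α | t ≤ f a} := fun ρ _ =>
    (hint ρ).integral_eq_integral_Ioc_meas_le (ae_of_all _ h0) (ae_of_all _ hM)
  have hint' : ∀ (ρ : Measure α) [IsProbabilityMeasure ρ],
      IntegrableOn (fun t => ρ.real {a : α | t ≤ f a}) (Set.Ioc 0 M) := by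
    intro ρ _
    have ha : Antitone fun t => ρ.real {a : α | t ≤ f a} := fun s t hst =>
      measureReal_mono fun x hx => le_trans hst hx
    exact (ha.antitoneOn _).integrableOn_isCompact isCompact_Icc |>.mono_set
      Set.Ioc_subset_Icc_self
  rw [hlc μ, hlc ν, ← integral_sub (hint' μ) (hint' ν), ← Real.norm_eq_abs]
  refine (norm_setIntegral_le_of_norm_le_const (C := (tv μ ν).toReal) (by simp)
    fun t _ => ?_).trans ?_
  · exact abs_real_sub_le_toReal_tv μ ν (measurableSet_le measurable_const hf)
  · simp [hM0, mul_comm]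

/-- Subtracting `a` changes both integrals equally, so only the oscillation of `f` counts. This is
the source of the factor `M - c < M` in the irreducible case. -/
theorem abs_integral_sub_le {f : α → ℝ} (hf : Measurable f) {a b : ℝ}
    (ha : ∀ x, a ≤ f x) (hb : ∀ x, f x ≤ b) :
    |∫ x, f x ∂μ - ∫ x, f x ∂ν| ≤ (b - a) * (tv μ ν).toReal := by
  have h := abs_integral_sub_le_of_nonneg μ ν (f := fun x => f x - a) (hf.sub_const a)
    (M := b - a) (fun x => sub_nonneg.2 (ha x)) (fun x => sub_le_sub_right (hb x) a)
  have hint : ∀ (ρ : Measure α) [IsProbabilityMeasure ρ], Integrable f ρ := fun ρ _ =>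
    Integrable.of_bound hf.aestronglyMeasurable (max |a| |b|)
      (ae_of_all _ fun x => abs_le_max_abs_abs (ha x) (hb x))
  rw [integral_sub (hint μ) (integrable_const a), integral_sub (hint ν) (integrable_const a)] at h
  simpa using h

theorem tv_bind_le (κ : Kernel α β) [IsMarkovKernel κ] :
    tv (μ.bind κ) (ν.bind κ) ≤ tv μ ν := by
  refine tv_le_iff.2 fun A hA => ENNReal.ofReal_le_of_le_toReal ?_
  rw [bind_real_apply μ κ hA, bind_real_apply ν κ hA]
  simpa using abs_integral_sub_le_of_nonneg μ ν (measurable_kernel_real κ hA)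
    (fun _ => measureReal_nonneg) (fun _ => measureReal_le_one)

theorem integrable_kernel_real (κ : Kernel α β) [IsMarkovKernel κ] {A : Set β}
    (hA : MeasurableSet A) : Integrable (fun x => (κ x).real A) μ :=
  Integrable.of_bound (measurable_kernel_real κ hA).aestronglyMeasurable 1
    (ae_of_all _ fun x => by
      rw [Real.norm_eq_abs, abs_of_nonneg measureReal_nonneg]; exact measureReal_le_one)

theorem tv_bind_bind_le (κ η : Kernel α β) [IsMarkovKernel κ] [IsMarkovKernel η] {d : ℝ≥0∞}
    (h : ∀ x, tv (κ x) (η x) ≤ d) : tv (μ.bind κ) (μ.bind η) ≤ d := by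
  rcases eq_or_ne d ∞ with rfl | hd
  · exact le_top
  refine tv_le_iff.2 fun A hA => ENNReal.ofReal_le_of_le_toReal ?_
  rw [bind_real_apply μ κ hA, bind_real_apply μ η hA,
    ← integral_sub (integrable_kernel_real μ κ hA) (integrable_kernel_real μ η hA),
    ← Real.norm_eq_abs]
  refine (norm_integral_le_of_norm_le_const (C := d.toReal) (ae_of_all _ fun x => ?_)).trans
    (by simp)
  exact (abs_real_sub_le_toReal_tv _ _ hA).trans (ENNReal.toReal_mono hd (h x))

end TotalVariation

/-! ### Stability of invariant laws under perturbation of the kernel -/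

section Chain

variable {α : Type*} [MeasurableSpace α]

instance isMarkovKernel_pow (κ : Kernel α α) [IsMarkovKernel κ] (n : ℕ) :
    IsMarkovKernel (κ ^ n) := by
  induction n with
  | zero => exact inferInstanceAs (IsMarkovKernel (Kernel.id : Kernel α α))
  | succ n ih =>
    rw [pow_succ]
    exact inferInstanceAs (IsMarkovKernel ((κ ^ n) ∘ₖ κ))

theorem bind_pow_zero (κ : Kernel α α) (μ : Measure α) : μ.bind (κ ^ 0 : Kernel α α) = μ :=
  Measure.id_comp

theorem bind_pow_succ (κ : Kernel α α) (μ : Measure α) (n : ℕ) :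
    μ.bind (κ ^ (n + 1) : Kernel α α) = (μ.bind (κ ^ n : Kernel α α)).bind κ := by
  rw [pow_succ']
  exact Measure.comp_assoc.symm

theorem pow_succ_apply_eq_bind (κ : Kernel α α) (n : ℕ) (x : α) :
    (κ ^ (n + 1)) x = ((κ ^ n) x).bind κ := by
  rw [pow_succ']
  exact Kernel.comp_apply _ _ _

theorem bind_pow_of_invariant {κ : Kernel α α} {μ : Measure α} (h : κ.Invariant μ) (n : ℕ) :
    μ.bind (κ ^ n : Kernel α α) = μ := by
  induction n with
  | zero => exact bind_pow_zero κ μ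
  | succ n ih => rw [bind_pow_succ, ih, h.def]

/-- Each step costs at most `d`: `κ` does not enlarge the error accumulated so far, and replacing
`η` by `κ` in `π = π.bind η` adds `d`. -/
theorem tv_bind_pow_le {κ η : Kernel α α} [IsMarkovKernel κ] [IsMarkovKernel η] {π : Measure α}
    [IsProbabilityMeasure π] (hπ : η.Invariant π) {d : ℝ≥0∞} (h : ∀ x, tv (η x) (κ x) ≤ d)
    (n : ℕ) : tv (π.bind (κ ^ n : Kernel α α)) π ≤ n * d := by
  induction n with
  | zero => rw [bind_pow_zero]; simp [tv]
  | succ n ih =>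
    rw [bind_pow_succ]
    calc _ ≤ tv ((π.bind (κ ^ n : Kernel α α)).bind κ) (π.bind κ) + tv (π.bind κ) π :=
          tv_triangle _ _ _
      _ ≤ n * d + d := by
          refine add_le_add ((tv_bind_le _ _ κ).trans ih) ?_
          nth_rewrite 2 [← hπ.def]
          exact tv_bind_bind_le π κ η fun x => (tv_comm _ _).trans_le (h x)
      _ = _ := by push_cast; ring

/-- The stationary distributions of Markov kernels close to `κ`, uniformly in the initial state,
are close to `P`. -/
def StablyStationary (κ : Kernel α α) (P : Measure α) : Prop :=
  ∀ ε : ℝ≥0∞, 0 < ε → ∃ C : ℝ≥0∞, C ≠ ∞ ∧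
    ∀ (η : Kernel α α) (π : Measure α) (d : ℝ≥0∞), IsMarkovKernel η → IsProbabilityMeasure π →
      η.Invariant π → d ≠ ∞ → (∀ x, tv (η x) (κ x) ≤ d) → tv π P ≤ ε + d * C

theorem UniformlyErgodic.stablyStationary {κ : Kernel α α} [IsMarkovKernel κ] {P : Measure α}
    [IsProbabilityMeasure P] (hP : κ.Invariant P) (h : UniformlyErgodic κ) :
    StablyStationary κ P := by
  obtain ⟨μ, hμ, hlim⟩ := h
  have key : ∀ (ρ : Measure α) [IsProbabilityMeasure ρ] (t : ℕ),
      tv (ρ.bind (κ ^ t : Kernel α α)) μ ≤ ⨆ z, tv ((κ ^ t) z) μ := by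
    intro ρ _ t
    have h1 := tv_bind_bind_le ρ (κ ^ t) (Kernel.const α μ)
      (fun x => le_iSup (fun z => tv ((κ ^ t) z) μ) x)
    rwa [show ρ.bind (Kernel.const α μ) = μ by simp] at h1
  -- The limit law can only be `P`, because `P` is fixed by every power.
  have hPμ : P = μ := by
    refine eq_of_tv_eq_zero (le_antisymm (ge_of_tendsto' hlim fun t => ?_) bot_le)
    simpa only [bind_pow_of_invariant hP t] using key P t
  subst hPμ
  intro ε hε
  obtain ⟨t, ht⟩ := (hlim.eventually (gt_mem_nhds hε)).exists
  refine ⟨t, ENNReal.natCast_ne_top t, fun η π d _ _ hπ _ hd => ?_⟩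
  calc tv π P ≤ tv π (π.bind (κ ^ t : Kernel α α)) + tv (π.bind (κ ^ t : Kernel α α)) P :=
        tv_triangle _ _ _
    _ ≤ t * d + ε := by
        refine add_le_add ?_ ((key π t).trans ht.le)
        rw [tv_comm]
        exact tv_bind_pow_le hπ hd t
    _ = _ := by ring

/-- With finitely many initial states, the times at which `A` is reached have a common bound and the
positive sums have a positive minimum. -/
theorem exists_forall_pos_le_sum_pow [Finite α] {κ : Kernel α α} {P : Measure α}
    (hκ : κ.IsIrreducible P) {A : Set α} (hA : MeasurableSet A) (hPA : 0 < P A) [IsMarkovKernel κ] :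
    ∃ (M : ℕ) (c : ℝ), 0 < c ∧ ∀ z, c ≤ ∑ k ∈ Finset.range M, ((κ ^ k) z).real A := by
  cases nonempty_fintype α
  choose n hn using hκ.irreducible hA hPA
  obtain ⟨M, hM⟩ : ∃ M, ∀ z, n z < M :=
    ⟨Finset.univ.sup n + 1, fun z => Nat.lt_succ_of_le (Finset.le_sup (Finset.mem_univ z))⟩
  have hpos : ∀ z, 0 < ∑ k ∈ Finset.range M, ((κ ^ k) z).real A := fun z =>
    Finset.sum_pos' (fun _ _ => measureReal_nonneg) ⟨n z, Finset.mem_range.2 (hM z),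
      ENNReal.toReal_pos (hn z).ne' (measure_ne_top _ _)⟩
  rcases isEmpty_or_nonempty α with _ | _
  · exact ⟨M, 1, one_pos, fun z => isEmptyElim z⟩
  · obtain ⟨z, hz⟩ := Finite.exists_min fun z => ∑ k ∈ Finset.range M, ((κ ^ k) z).real A
    exact ⟨M, _, hpos z, hz⟩

/-- A Doeblin argument with the sum of the first `M` powers, which puts mass at least `c` on an atom
`x` of `P` from every state. It yields `M * T ≤ M * M * d + (M - c) * T` for `T = tv π P`, hence a
bound linear in `d`, without the `ε` term. -/
theorem stablyStationary_of_isIrreducible [Finite α] [MeasurableSingletonClass α]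
    {κ : Kernel α α} [IsMarkovKernel κ] {P : Measure α} [IsProbabilityMeasure P]
    (hP : κ.Invariant P) (hκ : κ.IsIrreducible P) : StablyStationary κ P := by
  obtain ⟨x, hx⟩ : ∃ x, 0 < P {x} := by
    by_contra! h
    have h0 : P Set.univ = 0 := by
      rw [← Set.iUnion_of_singleton α]
      exact measure_iUnion_null fun x => le_antisymm (h x) bot_le
    simp at h0
  obtain ⟨M, c, hc, hcM⟩ := exists_forall_pos_le_sum_pow hκ (measurableSet_singleton x) hx
  intro ε _
  refine ⟨ENNReal.ofReal (M * M / c), ENNReal.ofReal_ne_top, fun η π d _ _ hπ hdt hd => ?_⟩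
  refine le_add_left ?_
  set T := (tv π P).toReal with hT
  have hM1 : ∀ (A : Set α) z, ∑ k ∈ Finset.range M, ((κ ^ k) z).real A ≤ M := fun A z => by
    simpa using Finset.sum_le_sum (s := Finset.range M)
      fun k _ => measureReal_le_one (μ := (κ ^ k) z) (s := A)
  have hcM' : c ≤ M := (hcM x).trans (hM1 _ x)
  have hM0 : (0 : ℝ) < M := hc.trans_le hcM'
  have hA : ∀ A, MeasurableSet A → M * |π.real A - P.real A| ≤ M * M * d.toReal + (M - c) * T := by
    intro A hA
    set f : α → ℝ := fun z => ∑ k ∈ Finset.range M, ((κ ^ k) z).real A with hf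
    have hfm : Measurable f :=
      Finset.measurable_sum _ fun k _ => measurable_kernel_real (κ ^ k) hA
    have hfi : ∀ (ρ : Measure α) [IsProbabilityMeasure ρ],
        ∫ z, f z ∂ρ = ∑ k ∈ Finset.range M, (ρ.bind (κ ^ k : Kernel α α)).real A := by
      intro ρ _
      rw [integral_finsetSum _ fun k _ => integrable_kernel_real ρ (κ ^ k) hA]
      exact Finset.sum_congr rfl fun k _ => (bind_real_apply ρ (κ ^ k) hA).symm
    -- `f` oscillates by at most `M - c`: if `x ∈ A` it is at least `c`; otherwise the mass `c` at
    -- `x` is lost to `A` and `f ≤ M - c`.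
    have h1 : |∫ z, f z ∂π - ∫ z, f z ∂P| ≤ (M - c) * T := by
      by_cases hxA : x ∈ A
      · refine abs_integral_sub_le π P hfm (fun z => (hcM z).trans ?_) (hM1 A)
        exact Finset.sum_le_sum fun k _ => measureReal_mono (by simpa using hxA)
      · have h := abs_integral_sub_le π P hfm (a := 0) (b := M - c)
          (fun z => Finset.sum_nonneg fun _ _ => measureReal_nonneg) (fun z => ?_)
        · simpa using h
        · have h2 := hM1 (A ∪ {x}) z
          have h3 : ∑ k ∈ Finset.range M, ((κ ^ k) z).real (A ∪ {x}) =
              f z + ∑ k ∈ Finset.range M, ((κ ^ k) z).real {x} := by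
            rw [hf, ← Finset.sum_add_distrib]
            exact Finset.sum_congr rfl fun k _ => measureReal_union
              (Set.disjoint_singleton_right.2 hxA) (measurableSet_singleton x)
          linarith [hcM z]
    have h2 : ∫ z, f z ∂P = M * P.real A := by
      rw [hfi P]
      simp [bind_pow_of_invariant hP]
    have h3 : |∫ z, f z ∂π - M * π.real A| ≤ M * M * d.toReal := by
      have h4 : ∫ z, f z ∂π - M * π.real A =
          ∑ k ∈ Finset.range M, ((π.bind (κ ^ k : Kernel α α)).real A - π.real A) := by
        rw [hfi π]; simp
      rw [h4]
      refine (Finset.abs_sum_le_sum_abs _ _).trans ?_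
      refine (Finset.sum_le_sum (g := fun _ => M * d.toReal) fun k hk => ?_).trans_eq ?_
      · refine (abs_real_sub_le_toReal_tv _ _ hA).trans ?_
        have h5 := ENNReal.toReal_mono (ENNReal.mul_ne_top (ENNReal.natCast_ne_top k) hdt)
          (tv_bind_pow_le hπ hd k)
        rw [ENNReal.toReal_mul, ENNReal.toReal_natCast] at h5
        refine h5.trans ?_
        have : (k : ℝ) ≤ M := by exact_mod_cast (Finset.mem_range.1 hk).le
        gcongr
      · simp [mul_assoc]
    rw [h2] at h1
    calc M * |π.real A - P.real A| = |M * π.real A - M * P.real A| := by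
          rw [← mul_sub, abs_mul, abs_of_pos hM0]
      _ ≤ |M * π.real A - ∫ z, f z ∂π| + |∫ z, f z ∂π - M * P.real A| := abs_sub_le _ _ _
      _ ≤ _ := by rw [abs_sub_comm (M * π.real A)]; linarith
  -- The right side of `hA` does not depend on `A`, so the supremum over `A` puts `T` on both sides
  -- and `(M - c) * T` can be absorbed.
  have hTb : T ≤ (M * M * d.toReal + (M - c) * T) / M := by
    have hT0 : 0 ≤ T := ENNReal.toReal_nonneg
    refine ENNReal.toReal_le_of_le_ofReal (by have := sub_nonneg.2 hcM'; positivity) ?_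
    refine tv_le_iff.2 fun A hAm => ENNReal.ofReal_le_ofReal ?_
    rw [le_div_iff₀ hM0, mul_comm]
    exact hA A hAm
  rw [le_div_iff₀ hM0] at hTb
  have hfin : T ≤ d.toReal * (M * M / c) := by
    rw [← mul_div_assoc, le_div_iff₀ hc]
    linarith
  calc tv π P = ENNReal.ofReal T := (ENNReal.ofReal_toReal (tv_ne_top π P)).symm
    _ ≤ _ := ENNReal.ofReal_le_ofReal hfin
    _ = _ := by rw [ENNReal.ofReal_mul ENNReal.toReal_nonneg, ENNReal.ofReal_toReal hdt]

end Chain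

/-! ### Marginals of kernels and asymptotic laws -/

section Kernels

variable {α β γ : Type*} [MeasurableSpace α] [MeasurableSpace β] [MeasurableSpace γ]

theorem bind_comap_fst (K : Kernel α γ) (μ : Measure (α × β)) :
    μ.bind (K.comap Prod.fst measurable_fst : Kernel (α × β) γ) = μ.fst.bind K := by
  ext A hA
  rw [Measure.bind_apply hA (Kernel.aemeasurable _), Measure.bind_apply hA (Kernel.aemeasurable _),
    Measure.fst, lintegral_map (K.measurable_coe hA) measurable_fst]
  rfl

theorem fst_bind (K : Kernel α (β × γ)) (μ : Measure α) : (μ.bind K).fst = μ.bind K.fst := by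
  rw [Kernel.fst_eq]
  exact Measure.map_comp μ K measurable_fst

theorem tv_le_sum_of_fintype [Fintype α]
    [MeasurableSingletonClass α] (μ ν : Measure α) [IsProbabilityMeasure μ]
    [IsProbabilityMeasure ν] : tv μ ν ≤ ∑ z, edist (μ.real {z}) (ν.real {z}) := by
  classical
  refine tv_le_iff.2 fun A _ => ?_
  have hsum : ∀ (ρ : Measure α) [IsProbabilityMeasure ρ],
      ρ.real A = ∑ z ∈ A.toFinset, ρ.real {z} := fun ρ _ => by
    rw [sum_measureReal_singleton, Set.coe_toFinset]
  rw [hsum μ, hsum ν, ← Finset.sum_sub_distrib]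
  refine (ENNReal.ofReal_le_ofReal (Finset.abs_sum_le_sum_abs _ _)).trans ?_
  rw [ENNReal.ofReal_sum_of_nonneg fun _ _ => abs_nonneg _]
  simp only [edist_dist, Real.dist_eq]
  exact Finset.sum_le_sum_of_subset (Finset.subset_univ _)

/-- By contraction, `(κ ^ (t + 1)) z` is close to `μ.bind κ` as well as to `μ`. -/
theorem IsAsymptotic.invariant {κ : Kernel α α} [IsMarkovKernel κ]
    {μ : Measure α} (h : IsAsymptotic κ μ) : κ.Invariant μ := by
  have := h.1
  obtain ⟨z⟩ : Nonempty α := μ.nonempty_of_neZero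
  refine eq_of_tv_eq_zero (le_antisymm ?_ bot_le)
  have hlim : Tendsto (fun t : ℕ => tv ((κ ^ t) z) μ + tv ((κ ^ (t + 1)) z) μ) atTop (𝓝 0) := by
    simpa using (h.2 z).add ((tendsto_add_atTop_iff_nat 1).2 (h.2 z))
  refine ge_of_tendsto' hlim fun t => (tv_triangle _ (((κ ^ t) z).bind κ) _).trans ?_
  refine add_le_add ((tv_bind_le _ _ κ).trans_eq (tv_comm _ _)) ?_
  rw [pow_succ_apply_eq_bind]

/-- For every `t`, `ν A` is the `ν`-average of `(κ ^ t) z A`; dominated convergence sends it to `μ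
A`. -/
theorem IsAsymptotic.eq_of_invariant {κ : Kernel α α}
    [IsMarkovKernel κ] {μ ν : Measure α} [IsProbabilityMeasure ν] (h : IsAsymptotic κ μ)
    (hν : κ.Invariant ν) : ν = μ := by
  have := h.1
  refine eq_of_tv_eq_zero (le_antisymm (tv_le_iff.2 fun A hA => ?_) bot_le)
  have hlim : ∀ z, Tendsto (fun t : ℕ => ((κ ^ t) z).real A) atTop (𝓝 (μ.real A)) := by
    intro z
    rw [tendsto_iff_dist_tendsto_zero]
    refine squeeze_zero (fun _ => dist_nonneg)
      (fun t => abs_real_sub_le_toReal_tv ((κ ^ t) z) μ hA) ?_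
    exact (ENNReal.tendsto_toReal ENNReal.zero_ne_top).comp (h.2 z)
  have hint := tendsto_integral_of_dominated_convergence (μ := ν) (fun _ => (1 : ℝ))
    (F := fun (t : ℕ) z => ((κ ^ t) z).real A) (f := fun _ => μ.real A)
    (fun t => (measurable_kernel_real (κ ^ t) hA).aestronglyMeasurable) (integrable_const _)
    (fun t => ae_of_all _ fun z => by
      rw [Real.norm_eq_abs, abs_of_nonneg measureReal_nonneg]; exact measureReal_le_one)
    (ae_of_all _ hlim)
  have hconst : ∀ t : ℕ, ∫ z, ((κ ^ t) z).real A ∂ν = ν.real A := fun t => by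
    rw [← bind_real_apply ν (κ ^ t) hA, bind_pow_of_invariant hν]
  simp only [hconst] at hint
  rw [tendsto_nhds_unique tendsto_const_nhds hint]
  simp

end Kernels

/-! ### Dependency networks: invariance and error bounds -/

section Network

theorem glue_rest_part {ι : Type*} {X : ι → Type*} [DecidableEq ι] (s : Finset ι)
    (x : ∀ i, X i) : glue s (rest s x) (part s x) = x := by
  funext i
  by_cases h : i ∈ s <;> simp [glue, rest, part, h]

variable {ι : Type*} {X : ι → Type*} [∀ i, MeasurableSpace (X i)]

theorem exists_pos_condError_lt [Finite ι] [∀ i, Finite (X i)]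
    [∀ i, MeasurableSingletonClass (X i)]
    (N₀ : DependencyNetwork X) (s : Finset ι) {δ : ℝ≥0∞} (hδ : 0 < δ) :
    ∃ η : ℝ≥0∞, 0 < η ∧ ∀ N : DependencyNetwork X,
      (∀ y z, edist ((N.cond s y).real {z}) ((N₀.cond s y).real {z}) < η) →
        condError N N₀ s < δ := by
  cases nonempty_fintype (Part X s)
  -- The supremum over `y` preserves only a weak bound, so room is left below `δ`.
  obtain ⟨δ', hδ', hlt⟩ := exists_between hδ
  obtain ⟨η, hη, hηδ⟩ := ENNReal.exists_nnreal_pos_mul_lt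
    (ENNReal.natCast_ne_top (Fintype.card (Part X s))) hδ'.ne'
  refine ⟨η, by exact_mod_cast hη, fun N hN => lt_of_le_of_lt (iSup_le fun y => ?_) hlt⟩
  calc tv (N.cond s y) (N₀.cond s y)
      ≤ ∑ z, edist ((N.cond s y).real {z}) ((N₀.cond s y).real {z}) := tv_le_sum_of_fintype _ _
    _ ≤ ∑ _z : Part X s, (η : ℝ≥0∞) := Finset.sum_le_sum fun z _ => (hN y z).le
    _ = η * Fintype.card (Part X s) := by simp [mul_comm]
    _ ≤ δ' := hηδ.le

theorem exists_pos_forall_edist_lt [Finite ι] [∀ i, Finite (X i)]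
    [∀ i, MeasurableSingletonClass (X i)]
    (p : PMF (Finset ι)) (N₀ : DependencyNetwork X) {δ : ℝ≥0∞} (hδ : 0 < δ) :
    ∃ η : ℝ≥0∞, 0 < η ∧ ∀ N : DependencyNetwork X,
      (∀ s ∈ p.support, ∀ y z, edist ((N.cond s y).real {z}) ((N₀.cond s y).real {z}) < η) →
        ∀ s ∈ p.support, condError N N₀ s < δ := by
  cases nonempty_fintype ι
  choose η hη h using fun s => exists_pos_condError_lt N₀ s hδ
  refine ⟨Finset.univ.inf η, ?_, fun N hN s hs => h s N fun y z =>
    (hN s hs y z).trans_le (Finset.inf_le (Finset.mem_univ s))⟩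
  exact (Finset.lt_inf_iff ENNReal.zero_lt_top).2 fun s _ => hη s

variable [DecidableEq ι]

theorem measurable_glue_right (s : Finset ι) (y : Rest X s) : Measurable (glue (X := X) s y) :=
  (measurable_glue s).comp measurable_prodMk_left

theorem resample_apply (N : DependencyNetwork X) (s : Finset ι) (π : Measure (∀ i, X i))
    [IsProbabilityMeasure π] {A : Set (∀ i, X i)} (hA : MeasurableSet A) :
    resample N s π A = ∫⁻ x, (N.cond s (rest s x)).map (glue s (rest s x)) A ∂π := by
  rw [resample, Measure.map_apply (measurable_glue s) hA,
    Measure.compProd_apply (measurable_glue s hA), lintegral_map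
      (Kernel.measurable_kernel_prodMk_left (measurable_glue s hA)) (measurable_rest s)]
  refine lintegral_congr fun x => ?_
  rw [Measure.map_apply (measurable_glue_right s _) hA]
  rfl

variable [Fintype ι]

instance (N : DependencyNetwork X) (p : PMF (Finset ι)) : IsMarkovKernel (gsn N p) := by
  have : IsMarkovKernel
      (((corruption p) ⊗ₖ (Kernel.prodMkLeft (∀ i, X i) (reconstruction N))).map Prod.swap) :=
    Kernel.IsMarkovKernel.map _ measurable_swap
  exact inferInstanceAs (IsMarkovKernel (Kernel.comap _ _ _))

instance (N : DependencyNetwork X) (p : PMF (Finset ι)) : IsMarkovKernel (visible N p) :=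
  inferInstanceAs (IsMarkovKernel (reconstruction N ∘ₖ corruption p))

/-- The transition of the GSN chain as a function of the visible component, which determines it. -/
theorem exists_gsn_eq_comap (N : DependencyNetwork X) (p : PMF (Finset ι)) :
    ∃ K : Kernel (∀ i, X i) ((∀ i, X i) × Latent X), IsMarkovKernel K ∧
      gsn N p = K.comap Prod.fst measurable_fst ∧ K.fst = visible N p := by
  refine ⟨((corruption p) ⊗ₖ (Kernel.prodMkLeft (∀ i, X i) (reconstruction N))).map Prod.swap,
    Kernel.IsMarkovKernel.map _ measurable_swap, rfl, ?_⟩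
  rw [Kernel.fst_eq, ← Kernel.map_comp_right _ measurable_swap measurable_fst, visible]
  rw [Kernel.comp_eq_snd_compProd, Kernel.snd_eq]
  rfl

theorem fst_bind_gsn (N : DependencyNetwork X) (p : PMF (Finset ι))
    (μ : Measure ((∀ i, X i) × Latent X)) : (μ.bind (gsn N p)).fst = μ.fst.bind (visible N p) := by
  obtain ⟨K, _, h1, h2⟩ := exists_gsn_eq_comap N p
  rw [h1, bind_comap_fst, fst_bind, h2]

theorem visible_apply (N : DependencyNetwork X) (p : PMF (Finset ι)) (x : ∀ i, X i) :
    visible N p x = ∑ s, p s • (N.cond s (rest s x)).map (glue s (rest s x)) := by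
  ext A hA
  rw [visible, Kernel.comp_apply' _ _ _ hA]
  change ∫⁻ h, reconstruction N h A ∂(∑ s, p s • Measure.dirac (⟨s, rest s x⟩ : Latent X)) = _
  rw [lintegral_finsetSum_measure]
  simp only [lintegral_smul_measure, lintegral_dirac' _ ((reconstruction N).measurable_coe hA),
    Measure.coe_finsetSum, Finset.sum_apply, Measure.smul_apply]
  rfl

theorem bind_visible (N : DependencyNetwork X) (p : PMF (Finset ι)) (π : Measure (∀ i, X i))
    [IsProbabilityMeasure π] : π.bind (visible N p) = ∑ s, p s • resample N s π := by
  have hm : ∀ (s : Finset ι) {A : Set (∀ i, X i)}, MeasurableSet A →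
      Measurable fun x => (N.cond s (rest s x)).map (glue s (rest s x)) A := fun s A hA =>
    ((reconstruction N).measurable_coe hA).comp ((measurable_mk s).comp (measurable_rest s))
  ext A hA
  rw [Measure.bind_apply hA (Kernel.aemeasurable _)]
  simp only [visible_apply, Measure.coe_finsetSum, Finset.sum_apply, Measure.smul_apply,
    smul_eq_mul, resample_apply N _ π hA]
  rw [lintegral_finsetSum _ fun s _ => (hm s hA).const_mul _]
  exact Finset.sum_congr rfl fun s _ => lintegral_const_mul _ (hm s hA)

theorem definesJoint_iff_invariant (N : DependencyNetwork X) (p : PMF (Finset ι))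
    (π : Measure (∀ i, X i)) :
    DefinesJoint N p π ↔ IsProbabilityMeasure π ∧ (visible N p).Invariant π := by
  refine and_congr_right fun _ => ?_
  rw [Kernel.Invariant, bind_visible, eq_comm]

theorem IsStationary.definesJoint {N : DependencyNetwork X} {p : PMF (Finset ι)}
    {μ : Measure ((∀ i, X i) × Latent X)} (h : IsStationary N p μ) : DefinesJoint N p μ.fst := by
  have := h.1
  refine (definesJoint_iff_invariant N p _).2 ⟨inferInstance, ?_⟩
  rw [Kernel.Invariant, ← fst_bind_gsn, h.2.def]

theorem definesJoint_iff_exists_isStationary (N : DependencyNetwork X) (p : PMF (Finset ι))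
    (π : Measure (∀ i, X i)) :
    DefinesJoint N p π ↔ ∃ μ, IsStationary N p μ ∧ μ.fst = π := by
  constructor
  · intro h
    obtain ⟨_, hinv⟩ := (definesJoint_iff_invariant N p π).1 h
    obtain ⟨K, _, h1, h2⟩ := exists_gsn_eq_comap N p
    have hfst : (π.bind K).fst = π := by rw [fst_bind, h2, hinv.def]
    -- One GSN step from `π` supplies the latent component; its visible marginal is again `π`, so a
    -- further step reproduces it.
    refine ⟨π.bind K, ⟨inferInstance, ?_⟩, hfst⟩
    rw [Kernel.Invariant, h1, bind_comap_fst, hfst]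
  · rintro ⟨μ, hμ, rfl⟩
    exact hμ.definesJoint

theorem fst_gsn_pow_apply (N : DependencyNetwork X) (p : PMF (Finset ι)) (t : ℕ)
    (z : (∀ i, X i) × Latent X) : ((gsn N p ^ t) z).fst = (visible N p ^ t) z.1 := by
  induction t with
  | zero =>
    change (Measure.dirac z).map Prod.fst = Measure.dirac z.1
    exact Measure.map_dirac' measurable_fst z
  | succ t ih => rw [pow_succ_apply_eq_bind, pow_succ_apply_eq_bind, fst_bind_gsn, ih]

theorem IsAsymptotic.visible {N : DependencyNetwork X} {p : PMF (Finset ι)}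
    {μ : Measure ((∀ i, X i) × Latent X)} (h : IsAsymptotic (gsn N p) μ) :
    IsAsymptotic (visible N p) μ.fst := by
  have := h.1
  refine ⟨inferInstance, fun x => ?_⟩
  refine tendsto_of_tendsto_of_tendsto_of_le_of_le tendsto_const_nhds
    -- The initial latent value has no influence on the visible marginals; this one is available for
    -- every `x`.
    (h.2 (x, ⟨∅, rest ∅ x⟩)) (fun _ => bot_le) fun t => ?_
  change tv ((DepNet.visible N p ^ t) x) μ.fst ≤ _
  rw [← fst_gsn_pow_apply N p t (x, ⟨∅, rest ∅ x⟩)]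
  exact tv_map_le _ _ measurable_fst

/-- Redrawing `x_s` from its true conditional rebuilds the joint law of `(x_{-s}, x_s)`, so each
selectable `s` preserves `P`; the others have weight zero. -/
theorem IsTrueConditionals.invariant {P : Measure (∀ i, X i)} [IsProbabilityMeasure P]
    {p : PMF (Finset ι)} {N : DependencyNetwork X} (h : IsTrueConditionals P p N) :
    (visible N p).Invariant P := by
  have hs : ∀ s ∈ p.support, resample N s P = P := by
    intro s hs
    have h1 := (h s hs).disintegrate
    rw [Measure.fst, Measure.map_map measurable_fst
      ((measurable_rest s).prodMk (measurable_part s))] at h1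
    change (P.map (rest s)) ⊗ₘ N.cond s = _ at h1
    rw [resample, h1, Measure.map_map (measurable_glue s)
      ((measurable_rest s).prodMk (measurable_part s))]
    convert Measure.map_id
    exact funext fun x => glue_rest_part s x
  rw [Kernel.Invariant, bind_visible]
  have : ∀ s, p s • resample N s P = p s • P := fun s => by
    by_cases hp : p s = 0
    · simp [hp]
    · rw [hs s ((p.mem_support_iff s).2 hp)]
  simp only [this]
  rw [← Finset.sum_smul, ← tsum_fintype (L := .unconditional _), p.tsum_coe, one_smul]

theorem tv_visible_le (N N₀ : DependencyNetwork X) (p : PMF (Finset ι)) (x : ∀ i, X i) :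
    tv (visible N p x) (visible N₀ p x) ≤ ∑ s, p s * condError N N₀ s := by
  refine tv_le_iff.2 fun A hA => ?_
  have hreal : ∀ N' : DependencyNetwork X, (visible N' p x).real A =
      ∑ s, (p s).toReal * (N'.cond s (rest s x)).real (glue s (rest s x) ⁻¹' A) := by
    intro N'
    rw [visible_apply, Measure.real, Measure.coe_finsetSum, Finset.sum_apply,
      ENNReal.toReal_sum fun s _ => ?_]
    · refine Finset.sum_congr rfl fun s _ => ?_
      rw [Measure.smul_apply, Measure.map_apply (measurable_glue_right s _) hA, smul_eq_mul,
        ENNReal.toReal_mul, Measure.real]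
    · rw [Measure.smul_apply, Measure.map_apply (measurable_glue_right s _) hA, smul_eq_mul]
      exact ENNReal.mul_ne_top (p.apply_ne_top s) (measure_ne_top _ _)
  rw [hreal, hreal, ← Finset.sum_sub_distrib]
  refine (ENNReal.ofReal_le_ofReal (Finset.abs_sum_le_sum_abs _ _)).trans ?_
  rw [ENNReal.ofReal_sum_of_nonneg fun _ _ => abs_nonneg _]
  refine Finset.sum_le_sum fun s _ => ?_
  rw [← mul_sub, abs_mul, abs_of_nonneg ENNReal.toReal_nonneg,
    ENNReal.ofReal_mul ENNReal.toReal_nonneg, ENNReal.ofReal_toReal (p.apply_ne_top s)]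
  gcongr
  exact (ofReal_abs_le_tv _ _ (measurable_glue_right s _ hA)).trans
    (le_iSup (fun y => tv (N.cond s y) (N₀.cond s y)) (rest s x))

/-- If the visible chain of the true network is stable, small errors of the conditionals yield
a small error of the joint distribution. -/
theorem StablyStationary.exists_condError_bound {P : Measure (∀ i, X i)} {p : PMF (Finset ι)}
    {N₀ : DependencyNetwork X} (h : StablyStationary (visible N₀ p) P) {ε : ℝ≥0∞} (hε : 0 < ε) :
    ∃ δ : ℝ≥0∞, 0 < δ ∧ ∀ (N : DependencyNetwork X) (μ : Measure ((∀ i, X i) × Latent X)),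
      IsStationary N p μ → (∀ s ∈ p.support, condError N N₀ s < δ) → tv μ.fst P < ε := by
  obtain ⟨ε', hε', hlt⟩ := exists_between hε
  obtain ⟨C, hC, hCb⟩ := h ε' hε'
  obtain ⟨δ, hδ, hδC⟩ := ENNReal.exists_nnreal_pos_mul_lt hC (tsub_pos_of_lt hlt).ne'
  refine ⟨δ, by exact_mod_cast hδ, fun N μ hμ hN => ?_⟩
  obtain ⟨hp, hinv⟩ := (definesJoint_iff_invariant N p _).1 hμ.definesJoint
  have hd : ∑ s, p s * condError N N₀ s ≤ δ := by
    calc ∑ s, p s * condError N N₀ s ≤ ∑ s, p s * δ := by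
          refine Finset.sum_le_sum fun s _ => ?_
          by_cases hs : p s = 0
          · simp [hs]
          · gcongr
            exact (hN s ((p.mem_support_iff s).2 hs)).le
      _ = δ := by
          rw [← Finset.sum_mul, ← tsum_fintype (L := .unconditional _), p.tsum_coe, one_mul]
  calc tv μ.fst P ≤ ε' + δ * C := hCb (visible N p) μ.fst δ inferInstance hp hinv
        ENNReal.coe_ne_top fun x => (tv_visible_le N N₀ p x).trans hd
    _ < ε' + (ε - ε') := ENNReal.add_lt_add_left (hlt.trans_le le_top).ne hδC
    _ = ε := add_tsub_cancel_of_le hlt.le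

end Network

/-! ### From an ε-δ bound to convergence in measure and almost surely -/

section Convergence

theorem edist_ennreal_zero_right (a : ℝ≥0∞) : edist a 0 = a := by
  cases a with
  | top => exact (ENNReal.edist_eq_top_iff _ _).2 ⟨ENNReal.top_ne_zero, Or.inl rfl⟩
  | coe a => exact (edist_nndist a 0).trans (by rw [NNReal.nndist_zero_eq_val'])

variable {Ω J : Type*} [MeasurableSpace Ω] {Pr : Measure Ω} [Finite J]
  {E : J → Type*} [∀ j, EDist (E j)] {f : ℕ → Ω → ℝ≥0∞}
  {g : ∀ j, ℕ → Ω → E j} {c : ∀ j, E j}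

/-- Up to a null set, `ε ≤ f n` forces some `g j n` to be at least `δ` away from `c j`; a union
bound over the finite `J` finishes. -/
theorem tendstoInMeasure_zero_of_forall_exists
    (h : ∀ ε : ℝ≥0∞, 0 < ε → ∃ δ : ℝ≥0∞, 0 < δ ∧ ∀ n, ∀ᵐ ω ∂Pr,
      (∀ j, edist (g j n ω) (c j) < δ) → f n ω < ε)
    (hg : ∀ j, TendstoInMeasure Pr (g j) atTop (fun _ => c j)) :
    TendstoInMeasure Pr f atTop (fun _ => 0) := by
  cases nonempty_fintype J
  intro ε hε
  obtain ⟨δ, hδ, hf⟩ := h ε hε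
  have hlim : Tendsto (fun n => ∑ j, Pr {ω | δ ≤ edist (g j n ω) (c j)}) atTop (𝓝 0) := by
    simpa using tendsto_finsetSum Finset.univ fun j _ => hg j δ hδ
  refine tendsto_of_tendsto_of_tendsto_of_le_of_le tendsto_const_nhds hlim (fun _ => bot_le)
    fun n => ?_
  calc Pr {ω | ε ≤ edist (f n ω) 0} ≤ Pr (⋃ j, {ω | δ ≤ edist (g j n ω) (c j)}) := by
        refine measure_mono_ae ?_
        filter_upwards [hf n] with ω hω hle
        change ε ≤ edist (f n ω) 0 at hle
        rw [edist_ennreal_zero_right] at hle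
        change ω ∈ ⋃ j, _
        by_contra hcon
        simp only [Set.mem_iUnion, Set.mem_ofPred_eq, not_exists, not_le] at hcon
        exact absurd (hω hcon) (not_lt.2 hle)
    _ ≤ _ := measure_iUnion_fintype_le Pr _

theorem ae_tendsto_zero_of_forall_exists
    (h : ∀ ε : ℝ≥0∞, 0 < ε → ∃ δ : ℝ≥0∞, 0 < δ ∧ ∀ n, ∀ᵐ ω ∂Pr,
      (∀ j, edist (g j n ω) (c j) < δ) → f n ω < ε)
    (hg : ∀ j, ∀ᵐ ω ∂Pr, Tendsto (fun n => edist (g j n ω) (c j)) atTop (𝓝 0)) :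
    ∀ᵐ ω ∂Pr, Tendsto (fun n => f n ω) atTop (𝓝 0) := by
  -- Countably many tolerances suffice, so the exceptional sets have a null union.
  obtain ⟨u, _, hu, hlim⟩ := exists_seq_strictAnti_tendsto' (α := ℝ≥0∞) ENNReal.zero_lt_top
  choose δ hδ hf using fun k => h (u k) (hu k).1
  filter_upwards [ae_all_iff.2 hg, ae_all_iff.2 fun k => ae_all_iff.2 (hf k)] with ω hω hfω
  rw [ENNReal.tendsto_nhds_zero]
  intro ε hε
  obtain ⟨k, hk⟩ := (hlim.eventually (gt_mem_nhds hε)).exists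
  have hev : ∀ᶠ n in atTop, ∀ j, edist (g j n ω) (c j) < δ k :=
    eventually_all.2 fun j => (hω j).eventually (gt_mem_nhds (hδ k))
  filter_upwards [hev] with n hn
  exact (hfω k n hn).le.trans hk.le

end Convergence

end DepNet

theorem mainTheorem3 {ι : Type*} [Fintype ι] [DecidableEq ι] (X : ι → Type*)
    [∀ i, MeasurableSpace (X i)] (p : PMF (Finset ι)) :
    -- The joint distributions defined by a network are exactly the visible marginals of the
    -- stationary distributions of its GSN chain; started from it, every `X_t` has this law.
    (∀ (N : DepNet.DependencyNetwork X) (π : Measure (∀ i, X i)),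
      (DepNet.DefinesJoint N p π ↔ ∃ μ, DepNet.IsStationary N p μ ∧ μ.fst = π) ∧
      (DepNet.DefinesJoint N p π → ∀ t : ℕ, π.bind (DepNet.visible N p ^ t) = π)) ∧
    -- If the chain has an asymptotic distribution, it is the unique stationary one, its visible
    -- marginal is the one joint distribution defined by the network, and `X_t` tends to it in law.
    (∀ (N : DepNet.DependencyNetwork X) (μ : Measure ((∀ i, X i) × DepNet.Latent X)),
      DepNet.IsAsymptotic (DepNet.gsn N p) μ →
        DepNet.IsStationary N p μ ∧
        (∀ ν, DepNet.IsStationary N p ν → ν = μ) ∧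
        (∀ π, DepNet.DefinesJoint N p π ↔ π = μ.fst) ∧
        DepNet.IsAsymptotic (DepNet.visible N p) μ.fst) ∧
    -- Consistency, for a ground truth `P` with conditionals `N₀`, estimated by random networks
    -- `N n ω` (`n` the sample size, `ω` the data).
    (∀ (P : Measure (∀ i, X i)) (N₀ : DepNet.DependencyNetwork X),
      IsProbabilityMeasure P → DepNet.IsTrueConditionals P p N₀ →
      ∀ {Ω : Type*} [MeasurableSpace Ω] (Pr : Measure Ω) [IsProbabilityMeasure Pr]
        (N : ℕ → Ω → DepNet.DependencyNetwork X)
        (μ : ℕ → Ω → Measure ((∀ i, X i) × DepNet.Latent X)),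
        (∀ n, ∀ᵐ ω ∂Pr, DepNet.IsStationary (N n ω) p (μ n ω)) →
        -- arbitrary variables, uniformly ergodic chain, uniform consistency
        (DepNet.UniformlyErgodic (DepNet.visible N₀ p) →
          ((∀ s ∈ p.support, TendstoInMeasure Pr
              (fun n ω => DepNet.condError (N n ω) N₀ s) atTop (fun _ => 0)) →
            TendstoInMeasure Pr (fun n ω => DepNet.tv (μ n ω).fst P) atTop (fun _ => 0)) ∧
          ((∀ s ∈ p.support, ∀ᵐ ω ∂Pr,
              Tendsto (fun n => DepNet.condError (N n ω) N₀ s) atTop (𝓝 0)) →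
            ∀ᵐ ω ∂Pr, Tendsto (fun n => DepNet.tv (μ n ω).fst P) atTop (𝓝 0))) ∧
        -- variables with finitely many values, irreducible chain, pointwise consistency
        ((∀ i, Finite (X i)) → (∀ i, MeasurableSingletonClass (X i)) →
          (DepNet.visible N₀ p).IsIrreducible P →
          ((∀ s ∈ p.support, ∀ y z, TendstoInMeasure Pr
              (fun n ω => ((N n ω).cond s y).real {z}) atTop
              (fun _ => (N₀.cond s y).real {z})) →
            TendstoInMeasure Pr (fun n ω => DepNet.tv (μ n ω).fst P) atTop (fun _ => 0)) ∧
          ((∀ s ∈ p.support, ∀ y z, ∀ᵐ ω ∂Pr,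
              Tendsto (fun n => ((N n ω).cond s y).real {z}) atTop
                (𝓝 ((N₀.cond s y).real {z}))) →
            ∀ᵐ ω ∂Pr, Tendsto (fun n => DepNet.tv (μ n ω).fst P) atTop (𝓝 0)))) := by

  refine ⟨fun N π => ⟨DepNet.definesJoint_iff_exists_isStationary N p π, fun h t =>
    DepNet.bind_pow_of_invariant ((DepNet.definesJoint_iff_invariant N p π).1 h).2 t⟩, ?_, ?_⟩
  · intro N μ h
    have huniq : ∀ ν, DepNet.IsStationary N p ν → ν = μ := fun ν hν =>
      have := hν.1
      h.eq_of_invariant hν.2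
    have hμ : DepNet.IsStationary N p μ := ⟨h.1, h.invariant⟩
    refine ⟨hμ, huniq, fun π => ⟨fun hπ => ?_, fun hπ => hπ ▸ hμ.definesJoint⟩, h.visible⟩
    obtain ⟨ν, hν, rfl⟩ := (DepNet.definesJoint_iff_exists_isStationary N p π).1 hπ
    rw [huniq ν hν]
  · intro P N₀ _ hP Ω _ Pr _ N μ hμ
    constructor
    · intro herg
      have hst := herg.stablyStationary hP.invariant
      have key : ∀ ε : ℝ≥0∞, 0 < ε → ∃ δ : ℝ≥0∞, 0 < δ ∧ ∀ n, ∀ᵐ ω ∂Pr,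
          (∀ j : p.support, edist (DepNet.condError (N n ω) N₀ j) 0 < δ) →
            DepNet.tv (μ n ω).fst P < ε := by
        intro ε hε
        obtain ⟨δ, hδ, h⟩ := hst.exists_condError_bound hε
        refine ⟨δ, hδ, fun n => ?_⟩
        filter_upwards [hμ n] with ω hω hj
        exact h _ _ hω fun s hs => (DepNet.edist_ennreal_zero_right _).symm.trans_lt
          (hj ⟨s, hs⟩)
      exact ⟨fun h => DepNet.tendstoInMeasure_zero_of_forall_exists key fun j => h j j.2,
        fun h => DepNet.ae_tendsto_zero_of_forall_exists key fun j => by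
          simpa only [DepNet.edist_ennreal_zero_right] using h j j.2⟩
    · intro _ _ hirr
      have hst := DepNet.stablyStationary_of_isIrreducible hP.invariant hirr
      have key : ∀ ε : ℝ≥0∞, 0 < ε → ∃ δ : ℝ≥0∞, 0 < δ ∧ ∀ n, ∀ᵐ ω ∂Pr,
          -- All entries of all selectable conditional tables form one finite index type, as the
          -- transfer lemmas require.
          (∀ j : (Σ s : p.support, DepNet.Rest X s × DepNet.Part X s),
            edist (((N n ω).cond j.1 j.2.1).real {j.2.2}) ((N₀.cond j.1 j.2.1).real {j.2.2})
              < δ) → DepNet.tv (μ n ω).fst P < ε := by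
        intro ε hε
        obtain ⟨δ, hδ, h⟩ := hst.exists_condError_bound hε
        obtain ⟨η, hη, h'⟩ := DepNet.exists_pos_forall_edist_lt p N₀ hδ
        refine ⟨η, hη, fun n => ?_⟩
        filter_upwards [hμ n] with ω hω hj
        exact h _ _ hω (h' _ fun s hs y z => hj ⟨⟨s, hs⟩, y, z⟩)
      exact ⟨fun h => DepNet.tendstoInMeasure_zero_of_forall_exists key
          fun j => h j.1 j.1.2 j.2.1 j.2.2,
        fun h => DepNet.ae_tendsto_zero_of_forall_exists key fun j => by
          simpa only [tendsto_iff_edist_tendsto_0] using h j.1 j.1.2 j.2.1 j.2.2⟩
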